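/- Let $n\ge 1$, let $\mathbb{D}=\{z\in\mathbb{C}:|z|<1\}$ and $S^1=\{z\in\mathbb{C}:|z|=1\}$. For $\alpha_0,\dots,\alpha_{n-2}\in\mathbb{D}$ and $\alpha_{n-1}\in S^1$ (Verblunsky coefficients) put $\rho_k=\sqrt{1-|\alpha_k|^2}$, $$\Xi_k=\begin{bmatrix}\bar\alpha_k&\rho_k\\ \rho_k&-\alpha_k\end{bmatrix}\quad(0\le k\le n-2),\qquad \Xi_{-1}=[1],\qquad \Xi_{n-1}=[\bar\alpha_{n-1}],$$ and form the $n\times n$ block-diagonal matrices $\mathcal{L}=\operatorname{diag}(\Xi_0,\Xi_2,\Xi_4,\dots)$ and $\mathcal{M}=\operatorname{diag}(\Xi_{-1},\Xi_1,\Xi_3,\dots)$. The CMV matrix associated to $\alpha_0,\dots,\alpha_{n-1}$ is $\mathcal{C}=\mathcal{L}\mathcal{M}$. A complex $n\times n$ matrix $U$, with rows and columns numbered $1,\dots,n$, has CMV shape if, for every $m\ge 0$, the entries in rows $2m+1$ and $2m+2$ vanish outside columns $2m,\,2m+1,\,2m+2,\,2m+3$, and the entries in position $(2,1)$ and in positions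 $(2j-1,2j+1)$ and $(2j+2,2j)$, $j\ge 1$, are positive real numbers; here only rows, columns and positions that lie within the $n\times n$ matrix are considered. Let $U$ be an $n\times n$ unitary matrix in CMV shape. Then there is a unique $n$-tuple of Verblunsky coefficients $\alpha_0,\dots,\alpha_{n-2}\in\mathbb{D}$, $\alpha_{n-1}\in S^1$ such that $U$ is the CMV matrix associated to these coefficients. -/

import Mathlib

namespace CMV

/-- The `2 × 2` block `Ξ(a) = [[ā, ρ], [ρ, -a]]` with `ρ = √(1 - |a|²)`. -/
noncomputable def Xi (a : ℂ) : Matrix (Fin 2) (Fin 2) ℂ :=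
  !![star a, (Real.sqrt (1 - ‖a‖ ^ 2) : ℂ);
     (Real.sqrt (1 - ‖a‖ ^ 2) : ℂ), -a]

/-- `L = diag(Ξ₀, Ξ₂, Ξ₄, …)`. Indices start at `0`; the block `Ξ_{2m}` sits in the rows and columns
`2m, 2m+1`. For odd `n` the last block has only the row and column `n - 1`, where the entry is
the top left entry of `Ξ(α_{n-1})`, so that this block is the `1 × 1` matrix `[ᾱ_{n-1}]`. -/
noncomputable def matL {n : ℕ} (α : Fin n → ℂ) : Matrix (Fin n) (Fin n) ℂ :=
  Matrix.of fun i j =>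
    if (i : ℕ) / 2 = (j : ℕ) / 2 then
      Xi (α ⟨2 * ((i : ℕ) / 2), by omega⟩)
        ⟨(i : ℕ) % 2, by omega⟩ ⟨(j : ℕ) % 2, by omega⟩
    else 0

/-- `M = diag(Ξ₋₁, Ξ₁, Ξ₃, …)` with `Ξ₋₁ = [1]`. Indices start at `0`; the block `Ξ_{2m+1}` sits in
the rows and columns `2m+1, 2m+2`. For even `n` the last block has only the row and column
`n - 1`, so that it is the `1 × 1` matrix `[ᾱ_{n-1}]`. -/
noncomputable def matM {n : ℕ} (α : Fin n → ℂ) : Matrix (Fin n) (Fin n) ℂ :=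
  Matrix.of fun i j =>
    if (i : ℕ) = 0 ∧ (j : ℕ) = 0 then 1
    else if h : 0 < (i : ℕ) ∧ 0 < (j : ℕ) ∧ ((i : ℕ) - 1) / 2 = ((j : ℕ) - 1) / 2 then
      Xi (α ⟨2 * (((i : ℕ) - 1) / 2) + 1, by omega⟩)
        ⟨((i : ℕ) - 1) % 2, by omega⟩ ⟨((j : ℕ) - 1) % 2, by omega⟩
    else 0

/-- The CMV matrix `L M` associated to the coefficients `α₀, …, α_{n-1}`. -/
noncomputable def cmvMatrix {n : ℕ} (α : Fin n → ℂ) : Matrix (Fin n) (Fin n) ℂ :=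
  matL α * matM α

/-- Verblunsky coefficients: `α₀, …, α_{n-2}` lie in the open unit disk, and `α_{n-1}` lies on the
unit circle. -/
def IsVerblunsky {n : ℕ} (α : Fin n → ℂ) : Prop :=
  (∀ k : Fin n, (k : ℕ) + 1 < n → ‖α k‖ < 1) ∧
  (∀ k : Fin n, (k : ℕ) + 1 = n → ‖α k‖ = 1)

/-- The entry `z` is a positive real number. -/
def IsPos (z : ℂ) : Prop := 0 < z.re ∧ z.im = 0

/-- CMV shape, with indices starting at `0`. The rows `2m, 2m+1` vanish outside of the columns
`2m-1, …, 2m+2`, and the exposed entries, in the positions `(1, 0)`, `(2m, 2m+2)` and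
`(2m+3, 2m+1)` with `m ≥ 0`, are positive wherever these positions lie in the matrix. -/
structure HasCMVShape {n : ℕ} (U : Matrix (Fin n) (Fin n) ℂ) : Prop where
  zero_left : ∀ i j : Fin n, (j : ℕ) + 1 < 2 * ((i : ℕ) / 2) → U i j = 0
  zero_right : ∀ i j : Fin n, 2 * ((i : ℕ) / 2) + 2 < (j : ℕ) → U i j = 0
  pos_first : ∀ i j : Fin n, (i : ℕ) = 1 → (j : ℕ) = 0 → IsPos (U i j)
  pos_upper : ∀ i j : Fin n, Even (i : ℕ) → (j : ℕ) = (i : ℕ) + 2 → IsPos (U i j)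
  pos_lower : ∀ i j : Fin n, Odd (j : ℕ) → (i : ℕ) = (j : ℕ) + 2 → IsPos (U i j)

end CMV

/-!
A CMV matrix is built up one coefficient at a time: `C(α₀, α₁, …) = (Ξ(α₀) ⊕ 1) (1 ⊕ C(α₁, …)ᵀ)`,
because `L(α) = Ξ(α₀) ⊕ L(α₂, …)`, `M(α) = 1 ⊕ L(α₁, …)` and both are symmetric. Conversely, the
first column of a unitary `U` in CMV shape is `(ᾱ, ρ, 0, …)` with `ρ > 0` and `|α|² + ρ² = 1`,
which is the first column of `Ξ(α) ⊕ 1`. Hence the unitary matrix `(Ξ(α) ⊕ 1)⁻¹ U` has a `1` in the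
corner, so it is `1 ⊕ Vᵀ`, and `V` is again a unitary matrix in CMV shape.
-/

namespace CMV

open Matrix

section BlockSum

variable {m n : ℕ} {R : Type*}

/-- The identification of `Fin m ⊕ Fin n` with `Fin (n + m)` that puts the `m` indices first. The
target is not written `Fin (m + n)` so that `Fin (n + 1)` and `Fin.succ` arise for `m = 1`. -/
def blockIndex (m n : ℕ) : Fin m ⊕ Fin n ≃ Fin (n + m) :=
  finSumFinEquiv.trans (finCongr (Nat.add_comm m n))

theorem blockIndex_inl (i : Fin m) :
    blockIndex m n (.inl i) = Fin.castLE (Nat.le_add_left m n) i := rfl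

theorem blockIndex_inr (i : Fin n) : blockIndex m n (.inr i) = i.addNat m :=
  Fin.ext (Nat.add_comm m i)

/-- The direct sum `A ⊕ B`, that is, the block diagonal matrix with `A` in the upper left corner and
`B` in the lower right one. -/
def blockSum [Zero R] (A : Matrix (Fin m) (Fin m) R) (B : Matrix (Fin n) (Fin n) R) :
    Matrix (Fin (n + m)) (Fin (n + m)) R :=
  reindex (blockIndex m n) (blockIndex m n) (fromBlocks A 0 0 B)

theorem blockSum_apply_blockIndex [Zero R] (A : Matrix (Fin m) (Fin m) R)
    (B : Matrix (Fin n) (Fin n) R) (x y : Fin m ⊕ Fin n) :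
    blockSum A B (blockIndex m n x) (blockIndex m n y) = fromBlocks A 0 0 B x y := by
  simp [blockSum]

theorem eq_blockSum_iff [Zero R] {A : Matrix (Fin m) (Fin m) R} {B : Matrix (Fin n) (Fin n) R}
    {M : Matrix (Fin (n + m)) (Fin (n + m)) R} :
    M = blockSum A B ↔
      (∀ i j, M (Fin.castLE (Nat.le_add_left m n) i) (Fin.castLE (Nat.le_add_left m n) j) = A i j) ∧
      (∀ i j, M (Fin.addNat i m) (Fin.castLE (Nat.le_add_left m n) j) = 0) ∧
      (∀ i j, M (Fin.castLE (Nat.le_add_left m n) i) (Fin.addNat j m) = 0) ∧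
      (∀ i j, M (Fin.addNat i m) (Fin.addNat j m) = B i j) := by
  simp only [← blockIndex_inl, ← blockIndex_inr, ← Matrix.ext_iff,
    ← (blockIndex m n).forall_congr_right, blockSum_apply_blockIndex, Sum.forall,
    fromBlocks_apply₁₁, fromBlocks_apply₁₂, fromBlocks_apply₂₁, fromBlocks_apply₂₂,
    Matrix.zero_apply, forall_and, and_assoc]

theorem blockSum_inj [Zero R] {A A' : Matrix (Fin m) (Fin m) R} {B B' : Matrix (Fin n) (Fin n) R} :
    blockSum A B = blockSum A' B' ↔ A = A' ∧ B = B' := by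
  rw [blockSum, blockSum, EmbeddingLike.apply_eq_iff_eq, fromBlocks_inj]
  simp

theorem blockSum_one [Zero R] [One R] :
    blockSum (1 : Matrix (Fin m) (Fin m) R) (1 : Matrix (Fin n) (Fin n) R) = 1 := by
  simp [blockSum]

theorem blockSum_mul_blockSum [NonUnitalNonAssocSemiring R] (A A' : Matrix (Fin m) (Fin m) R)
    (B B' : Matrix (Fin n) (Fin n) R) :
    blockSum A B * blockSum A' B' = blockSum (A * A') (B * B') := by
  simp [blockSum, fromBlocks_multiply]

theorem blockSum_transpose [Zero R] (A : Matrix (Fin m) (Fin m) R) (B : Matrix (Fin n) (Fin n) R) :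
    (blockSum A B)ᵀ = blockSum Aᵀ Bᵀ := by
  simp [blockSum, fromBlocks_transpose]

theorem star_blockSum [AddMonoid R] [StarAddMonoid R] (A : Matrix (Fin m) (Fin m) R)
    (B : Matrix (Fin n) (Fin n) R) : star (blockSum A B) = blockSum (star A) (star B) := by
  simp [blockSum, star_eq_conjTranspose, fromBlocks_conjTranspose]

theorem blockSum_mem_unitaryGroup_iff [CommRing R] [StarRing R] {A : Matrix (Fin m) (Fin m) R}
    {B : Matrix (Fin n) (Fin n) R} :
    blockSum A B ∈ unitaryGroup (Fin (n + m)) R ↔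
      A ∈ unitaryGroup (Fin m) R ∧ B ∈ unitaryGroup (Fin n) R := by
  simp only [mem_unitaryGroup_iff, star_blockSum, blockSum_mul_blockSum, ← blockSum_one,
    blockSum_inj]

theorem isUnit_blockSum [CommRing R] {A : Matrix (Fin m) (Fin m) R} {B : Matrix (Fin n) (Fin n) R}
    (hA : IsUnit A) (hB : IsUnit B) : IsUnit (blockSum A B) := by
  obtain ⟨A', hA'⟩ := hA.exists_right_inv
  obtain ⟨B', hB'⟩ := hB.exists_right_inv
  refine .of_mul_eq_one (blockSum A' B') ?_
  rw [blockSum_mul_blockSum, hA', hB', blockSum_one]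

theorem blockSum_mul_apply_castLE [NonUnitalNonAssocSemiring R] (A : Matrix (Fin m) (Fin m) R)
    (B : Matrix (Fin n) (Fin n) R) (X : Matrix (Fin (n + m)) (Fin (n + m)) R) (i : Fin m)
    (j : Fin (n + m)) :
    (blockSum A B * X) (Fin.castLE (Nat.le_add_left m n) i) j =
      ∑ k, A i k * X (Fin.castLE (Nat.le_add_left m n) k) j := by
  simp only [← blockIndex_inl, mul_apply, ← (blockIndex m n).sum_comp, Fintype.sum_sum_type,
    blockSum_apply_blockIndex, fromBlocks_apply₁₁, fromBlocks_apply₁₂, Matrix.zero_apply, zero_mul,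
    Finset.sum_const_zero, add_zero]

theorem blockSum_mul_apply_addNat [NonUnitalNonAssocSemiring R] (A : Matrix (Fin m) (Fin m) R)
    (B : Matrix (Fin n) (Fin n) R) (X : Matrix (Fin (n + m)) (Fin (n + m)) R) (i : Fin n)
    (j : Fin (n + m)) :
    (blockSum A B * X) (i.addNat m) j = ∑ k, B i k * X (k.addNat m) j := by
  simp only [← blockIndex_inr, mul_apply, ← (blockIndex m n).sum_comp, Fintype.sum_sum_type,
    blockSum_apply_blockIndex, fromBlocks_apply₂₁, fromBlocks_apply₂₂, Matrix.zero_apply, zero_mul,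
    Finset.sum_const_zero, zero_add]

theorem blockSum_mul_apply_zero [NonUnitalNonAssocSemiring R] (A : Matrix (Fin 2) (Fin 2) R)
    (B : Matrix (Fin n) (Fin n) R) (X : Matrix (Fin (n + 2)) (Fin (n + 2)) R) (j : Fin (n + 2)) :
    (blockSum A B * X) 0 j = A 0 0 * X 0 j + A 0 1 * X 1 j :=
  (blockSum_mul_apply_castLE A B X 0 j).trans (Fin.sum_univ_two _)

section OneByOne

variable [Zero R] (A : Matrix (Fin 1) (Fin 1) R) (B : Matrix (Fin n) (Fin n) R)

@[simp]
theorem blockSum_zero_zero : blockSum A B 0 0 = A 0 0 :=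
  (eq_blockSum_iff.1 (rfl : blockSum A B = blockSum A B)).1 0 0

@[simp]
theorem blockSum_succ_zero (i : Fin n) : blockSum A B i.succ 0 = 0 :=
  (eq_blockSum_iff.1 (rfl : blockSum A B = blockSum A B)).2.1 i 0

@[simp]
theorem blockSum_zero_succ (j : Fin n) : blockSum A B 0 j.succ = 0 :=
  (eq_blockSum_iff.1 (rfl : blockSum A B = blockSum A B)).2.2.1 0 j

@[simp]
theorem blockSum_succ_succ (i j : Fin n) : blockSum A B i.succ j.succ = B i j :=
  (eq_blockSum_iff.1 (rfl : blockSum A B = blockSum A B)).2.2.2 i j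

end OneByOne

theorem blockSum_one_blockSum_one [Zero R] [One R] (A : Matrix (Fin n) (Fin n) R) :
    blockSum (1 : Matrix (Fin 1) (Fin 1) R) (blockSum (1 : Matrix (Fin 1) (Fin 1) R) A) =
      blockSum (1 : Matrix (Fin 2) (Fin 2) R) A := by
  refine (eq_blockSum_iff (A := (1 : Matrix (Fin 2) (Fin 2) R))).2
    ⟨?_, fun i => ?_, ?_, fun i j => ?_⟩
  · simp only [Fin.forall_fin_two]
    exact ⟨⟨blockSum_zero_zero _ _, blockSum_zero_succ _ _ 0⟩, blockSum_succ_zero _ _ 0,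
      (blockSum_succ_succ _ _ 0 0).trans (blockSum_zero_zero _ _)⟩
  · exact Fin.forall_fin_two.2 ⟨blockSum_succ_zero _ _ i.succ,
      (blockSum_succ_succ _ _ i.succ 0).trans (blockSum_succ_zero _ _ i)⟩
  · exact Fin.forall_fin_two.2 ⟨fun j => blockSum_zero_succ _ _ j.succ,
      fun j => (blockSum_succ_succ _ _ 0 j.succ).trans (blockSum_zero_succ _ _ j)⟩
  · exact (blockSum_succ_succ _ _ i.succ j.succ).trans (blockSum_succ_succ _ _ i j)

end BlockSum

section Unitary

variable {ι 𝕜 : Type*} [Fintype ι] [DecidableEq ι] [RCLike 𝕜] {U : Matrix ι ι 𝕜}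

theorem sum_norm_sq_col_of_mem_unitaryGroup (hU : U ∈ unitaryGroup ι 𝕜) (j : ι) :
    ∑ i, ‖U i j‖ ^ 2 = 1 := by
  have h : (star U * U) j j = 1 := by rw [mem_unitaryGroup_iff'.1 hU, one_apply_eq]
  simp only [mul_apply, star_apply, RCLike.star_def, RCLike.conj_mul] at h
  exact_mod_cast h

theorem apply_eq_zero_of_norm_eq_one_col (hU : U ∈ unitaryGroup ι 𝕜) {i j k : ι}
    (hij : ‖U i j‖ = 1) (hki : k ≠ i) : U k j = 0 := by
  have h := sum_norm_sq_col_of_mem_unitaryGroup hU j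
  rw [← Finset.add_sum_erase _ _ (Finset.mem_univ i), hij, one_pow, add_eq_left,
    Finset.sum_eq_zero_iff_of_nonneg fun _ _ => by positivity] at h
  simpa using h k (by simp [hki])

theorem apply_eq_zero_of_norm_eq_one_row (hU : U ∈ unitaryGroup ι 𝕜) {i j k : ι}
    (hij : ‖U i j‖ = 1) (hkj : k ≠ j) : U i k = 0 :=
  apply_eq_zero_of_norm_eq_one_col (transpose_mem_unitaryGroup_iff.2 hU) hij hkj

theorem exists_eq_one_blockSum_of_apply_zero_zero {n : ℕ} {W : Matrix (Fin (n + 1)) (Fin (n + 1)) 𝕜}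
    (hW : W ∈ unitaryGroup (Fin (n + 1)) 𝕜) (hW₀ : W 0 0 = 1) :
    ∃ V ∈ unitaryGroup (Fin n) 𝕜, W = blockSum (1 : Matrix (Fin 1) (Fin 1) 𝕜) V := by
  have hnorm : ‖W 0 0‖ = 1 := by rw [hW₀, norm_one]
  have hblock : W = blockSum (1 : Matrix (Fin 1) (Fin 1) 𝕜) (W.submatrix Fin.succ Fin.succ) := by
    refine eq_blockSum_iff.2 ⟨?_, ?_, ?_, fun _ _ => rfl⟩
    · simpa [Fin.forall_fin_one] using hW₀
    · simpa [Fin.forall_fin_one] using fun i : Fin n =>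
        apply_eq_zero_of_norm_eq_one_col hW hnorm i.succ_ne_zero
    · simpa [Fin.forall_fin_one] using fun j : Fin n =>
        apply_eq_zero_of_norm_eq_one_row hW hnorm j.succ_ne_zero
  exact ⟨_, (blockSum_mem_unitaryGroup_iff.1 (hblock ▸ hW)).2, hblock⟩

theorem exists_eq_mul_one_blockSum_of_col_zero_eq {n : ℕ}
    {U E : Matrix (Fin (n + 1)) (Fin (n + 1)) 𝕜}
    (hU : U ∈ unitaryGroup (Fin (n + 1)) 𝕜) (hE : E ∈ unitaryGroup (Fin (n + 1)) 𝕜)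
    (hcol : ∀ i, U i 0 = E i 0) :
    ∃ V ∈ unitaryGroup (Fin n) 𝕜, U = E * blockSum (1 : Matrix (Fin 1) (Fin 1) 𝕜) V := by
  have hcorner : (star E * U) 0 0 = 1 := calc
    (star E * U) 0 0 = (star E * E) 0 0 := by simp only [mul_apply, hcol]
    _ = 1 := by rw [mem_unitaryGroup_iff'.1 hE, one_apply_eq]
  obtain ⟨V, hV, hVU⟩ :=
    exists_eq_one_blockSum_of_apply_zero_zero (mul_mem (Unitary.star_mem hE) hU) hcorner
  exact ⟨V, hV, by rw [← hVU, ← Matrix.mul_assoc, mem_unitaryGroup_iff.1 hE, Matrix.one_mul]⟩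

end Unitary

section Xi

theorem transpose_Xi (a : ℂ) : (Xi a)ᵀ = Xi a := by
  ext i j
  fin_cases i <;> fin_cases j <;> rfl

theorem Xi_mem_unitaryGroup {a : ℂ} (ha : ‖a‖ ≤ 1) : Xi a ∈ unitaryGroup (Fin 2) ℂ := by
  have hρ : (√(1 - ‖a‖ ^ 2) : ℂ) * √(1 - ‖a‖ ^ 2) = 1 - star a * a := by
    rw [← Complex.ofReal_mul, Real.mul_self_sqrt (by nlinarith [norm_nonneg a]),
      Complex.star_def, Complex.conj_mul']
    push_cast
    rfl
  rw [mem_unitaryGroup_iff]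
  ext i j
  fin_cases i <;> fin_cases j <;>
    simp [Xi, mul_apply, Fin.sum_univ_two, hρ, mul_comm]

theorem isUnit_Xi (a : ℂ) : IsUnit (Xi a) := by
  have hdet : (Xi a).det = ((-(‖a‖ ^ 2 + √(1 - ‖a‖ ^ 2) ^ 2) : ℝ) : ℂ) := by
    rw [Xi, det_fin_two_of, Complex.star_def, mul_neg, Complex.conj_mul']
    push_cast
    ring
  -- For `‖a‖ > 1` the real square root is `0`, so this is not just the identity `|a|² + ρ² = 1`.
  have hpos : 0 < ‖a‖ ^ 2 + √(1 - ‖a‖ ^ 2) ^ 2 := by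
    linarith [Real.sq_sqrt' (x := 1 - ‖a‖ ^ 2), le_max_left (1 - ‖a‖ ^ 2) 0]
  rw [isUnit_iff_isUnit_det, hdet, isUnit_iff_ne_zero]
  exact_mod_cast (neg_neg_of_pos hpos).ne

end Xi

section IsPos

theorem isPos_ofReal_mul_iff {r : ℝ} (hr : 0 < r) {z : ℂ} : IsPos (r * z) ↔ IsPos z := by
  simp [IsPos, hr, hr.ne']

open scoped ComplexOrder in
theorem IsPos.ofReal_norm {z : ℂ} (hz : IsPos z) : (‖z‖ : ℂ) = z :=
  Complex.norm_of_nonneg' (Complex.pos_iff.2 ⟨hz.1, hz.2.symm⟩).le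

end IsPos

section Prepend

variable {n : ℕ}

/-- The matrix `(Ξ(a) ⊕ 1) (1 ⊕ Vᵀ)`. Applied to the CMV matrix `V` of `α₀, α₁, …`, it yields the
CMV matrix of `a, α₀, α₁, …`. -/
noncomputable def prepend (a : ℂ) (V : Matrix (Fin (n + 1)) (Fin (n + 1)) ℂ) :
    Matrix (Fin (n + 2)) (Fin (n + 2)) ℂ :=
  blockSum (Xi a) (1 : Matrix (Fin n) (Fin n) ℂ) * blockSum (1 : Matrix (Fin 1) (Fin 1) ℂ) Vᵀ

theorem prepend_zero_zero (a : ℂ) (V : Matrix (Fin (n + 1)) (Fin (n + 1)) ℂ) :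
    prepend a V 0 0 = star a := by
  have hone : blockSum (1 : Matrix (Fin 1) (Fin 1) ℂ) Vᵀ 1 0 = 0 := blockSum_succ_zero 1 Vᵀ 0
  simp [prepend, blockSum_mul_apply_zero, hone, Xi]

theorem prepend_zero_succ (a : ℂ) (V : Matrix (Fin (n + 1)) (Fin (n + 1)) ℂ) (i : Fin (n + 1)) :
    prepend a V 0 i.succ = √(1 - ‖a‖ ^ 2) * V i 0 := by
  have hone : blockSum (1 : Matrix (Fin 1) (Fin 1) ℂ) Vᵀ 1 i.succ = V i 0 :=
    blockSum_succ_succ 1 Vᵀ 0 i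
  simp [prepend, blockSum_mul_apply_zero, hone, Xi]

theorem prepend_succ_succ (a : ℂ) (V : Matrix (Fin (n + 1)) (Fin (n + 1)) ℂ) (i : Fin n)
    (j : Fin (n + 1)) : prepend a V i.succ.succ j.succ = V j i.succ := by
  have hrow : prepend a V i.succ.succ j.succ =
      ∑ k, (1 : Matrix (Fin n) (Fin n) ℂ) i k *
        blockSum (1 : Matrix (Fin 1) (Fin 1) ℂ) Vᵀ k.succ.succ j.succ :=
    blockSum_mul_apply_addNat (Xi a) 1 _ i j.succ
  simpa [one_apply] using hrow

theorem prepend_inj {a b : ℂ} {V W : Matrix (Fin (n + 1)) (Fin (n + 1)) ℂ} :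
    prepend a V = prepend b W ↔ a = b ∧ V = W := by
  refine ⟨fun h => ?_, fun ⟨hab, hVW⟩ => hab ▸ hVW ▸ rfl⟩
  obtain rfl : a = b := star_injective <| by
    rw [← prepend_zero_zero a V, h, prepend_zero_zero]
  have hV : blockSum (1 : Matrix (Fin 1) (Fin 1) ℂ) Vᵀ = blockSum 1 Wᵀ :=
    (isUnit_blockSum (isUnit_Xi a) isUnit_one).mul_left_cancel h
  exact ⟨rfl, transpose_injective (blockSum_inj.1 hV).2⟩

theorem HasCMVShape.of_prepend {a : ℂ} (ha : ‖a‖ < 1)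
    {V : Matrix (Fin (n + 1)) (Fin (n + 1)) ℂ} (h : HasCMVShape (prepend a V)) :
    HasCMVShape V := by
  have hρ : 0 < √(1 - ‖a‖ ^ 2) := Real.sqrt_pos.2 (by nlinarith [norm_nonneg a])
  have hρ' : (√(1 - ‖a‖ ^ 2) : ℂ) ≠ 0 := by exact_mod_cast hρ.ne'
  constructor
  · intro i j hij
    cases j using Fin.cases with
    | zero =>
      have h₀ := h.zero_right 0 i.succ (by simp only [Fin.val_succ, Fin.val_zero] at hij ⊢; omega)
      exact (mul_eq_zero.1 ((prepend_zero_succ a V i).symm.trans h₀)).resolve_left hρ'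
    | succ j =>
      rw [← prepend_succ_succ a V]
      exact h.zero_right _ _ (by simp only [Fin.val_succ] at hij ⊢; omega)
  · intro i j hij
    cases j using Fin.cases with
    | zero => simp at hij
    | succ j =>
      rw [← prepend_succ_succ a V]
      exact h.zero_left _ _ (by simp only [Fin.val_succ] at hij ⊢; omega)
  · intro i j hi hj
    obtain rfl : j = 0 := Fin.ext hj
    rw [← isPos_ofReal_mul_iff hρ, ← prepend_zero_succ]
    exact h.pos_upper _ _ (by simp) (by simp [hi])
  · intro i j hi hij
    cases j using Fin.cases with
    | zero => simp at hij
    | succ j =>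
      rw [← prepend_succ_succ a V]
      exact h.pos_lower _ _ (by simpa using hi.add_one)
        (by simp only [Fin.val_succ] at hij ⊢; omega)
  · intro i j hj hij
    cases j using Fin.cases with
    | zero => simp at hj
    | succ j =>
      rw [← prepend_succ_succ a V]
      exact h.pos_upper _ _ (by simpa using hj.add_one)
        (by simp only [Fin.val_succ] at hij ⊢; omega)

theorem exists_col_zero_eq_blockSum_Xi {U : Matrix (Fin (n + 2)) (Fin (n + 2)) ℂ}
    (hU : U ∈ unitaryGroup (Fin (n + 2)) ℂ) (hpos : IsPos (U 1 0))
    (hzero : ∀ i : Fin n, U i.succ.succ 0 = 0) :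
    ∃ a : ℂ, ‖a‖ < 1 ∧ ∀ i, U i 0 = blockSum (Xi a) (1 : Matrix (Fin n) (Fin n) ℂ) i 0 := by
  have hnorm : ‖U 0 0‖ ^ 2 + ‖U 1 0‖ ^ 2 = 1 := by
    simpa [Fin.sum_univ_succ, hzero] using sum_norm_sq_col_of_mem_unitaryGroup hU 0
  have hpos' : 0 < ‖U 1 0‖ := norm_pos_iff.2 fun h => by simp [IsPos, h] at hpos
  have hρ : √(1 - ‖U 0 0‖ ^ 2) = ‖U 1 0‖ := by
    rw [← hnorm, add_sub_cancel_left, Real.sqrt_sq hpos'.le]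
  obtain ⟨hupper, hlower, -, -⟩ :=
    eq_blockSum_iff.1 (rfl : blockSum (Xi (star (U 0 0))) (1 : Matrix (Fin n) (Fin n) ℂ) = _)
  refine ⟨star (U 0 0), ?_, ?_⟩
  · rw [norm_star]
    nlinarith [norm_nonneg (U 0 0), pow_pos hpos' 2]
  · simp only [Fin.forall_fin_succ]
    refine ⟨.trans ?_ (hupper 0 0).symm, .trans ?_ (hupper 1 0).symm,
      fun i => (hzero i).trans (hlower i 0).symm⟩
    · simp [Xi]
    · simp [Xi, hρ, hpos.ofReal_norm]

theorem exists_eq_prepend {U : Matrix (Fin (n + 2)) (Fin (n + 2)) ℂ}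
    (hU : U ∈ unitaryGroup (Fin (n + 2)) ℂ) (hpos : IsPos (U 1 0))
    (hzero : ∀ i : Fin n, U i.succ.succ 0 = 0) :
    ∃ a : ℂ, ‖a‖ < 1 ∧ ∃ V ∈ unitaryGroup (Fin (n + 1)) ℂ, U = prepend a V := by
  obtain ⟨a, ha, hcol⟩ := exists_col_zero_eq_blockSum_Xi hU hpos hzero
  have hE : blockSum (Xi a) (1 : Matrix (Fin n) (Fin n) ℂ) ∈ unitaryGroup (Fin (n + 2)) ℂ :=
    blockSum_mem_unitaryGroup_iff.2 ⟨Xi_mem_unitaryGroup ha.le, one_mem _⟩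
  obtain ⟨W, hW, rfl⟩ := exists_eq_mul_one_blockSum_of_col_zero_eq hU hE hcol
  exact ⟨a, ha, Wᵀ, transpose_mem_unitaryGroup_iff.2 hW, by rw [prepend, transpose_transpose]⟩

end Prepend

section CMVMatrix

variable {n : ℕ}

theorem matM_eq_blockSum (α : Fin (n + 1) → ℂ) :
    matM α = blockSum (1 : Matrix (Fin 1) (Fin 1) ℂ) (matL (Fin.tail α)) := by
  rw [eq_blockSum_iff]
  refine ⟨?_, ?_, ?_, fun i j => ?_⟩
  · simp [Fin.forall_fin_one, matM]
  · simp [matM]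
  · simp [matM]
  · by_cases hij : (i : ℕ) / 2 = (j : ℕ) / 2 <;> simp [matM, matL, Fin.tail, hij]

theorem matL_eq_blockSum (α : Fin (n + 2) → ℂ) :
    matL α = blockSum (Xi (α 0)) (matL (Fin.tail (Fin.tail α))) := by
  rw [eq_blockSum_iff]
  simp [Fin.forall_fin_two, matL, Fin.tail, Nat.mul_add]

theorem isSymm_matL : ∀ {n : ℕ} (α : Fin n → ℂ), (matL α).IsSymm
  | 0, _ => Subsingleton.elim _ _
  | 1, _ => by ext i j; rw [Subsingleton.elim i j]; rfl
  | n + 2, α => by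
    rw [matL_eq_blockSum, Matrix.IsSymm, blockSum_transpose, transpose_Xi, isSymm_matL]

theorem isSymm_matM (α : Fin (n + 1) → ℂ) : (matM α).IsSymm := by
  rw [matM_eq_blockSum, Matrix.IsSymm, blockSum_transpose, transpose_one, isSymm_matL]

theorem cmvMatrix_eq_prepend (α : Fin (n + 2) → ℂ) :
    cmvMatrix α = prepend (α 0) (cmvMatrix (Fin.tail α)) := by
  have hL : matL α = blockSum (Xi (α 0)) (1 : Matrix (Fin n) (Fin n) ℂ) *
      blockSum (1 : Matrix (Fin 1) (Fin 1) ℂ) (matM (Fin.tail α)) := by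
    rw [matM_eq_blockSum, blockSum_one_blockSum_one, blockSum_mul_blockSum, mul_one, one_mul,
      matL_eq_blockSum]
  rw [cmvMatrix, hL, matM_eq_blockSum α, Matrix.mul_assoc, blockSum_mul_blockSum, mul_one, prepend,
    cmvMatrix, transpose_mul, isSymm_matL, isSymm_matM]

theorem cmvMatrix_apply_zero_zero (α : Fin (n + 1) → ℂ) : cmvMatrix α 0 0 = star (α 0) := by
  cases n with
  | zero => simp [cmvMatrix, mul_apply, matL, matM, Xi]
  | succ n => rw [cmvMatrix_eq_prepend, prepend_zero_zero]

theorem cmvMatrix_injective : ∀ {n : ℕ}, Function.Injective (cmvMatrix (n := n))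
  | 0, _, _, _ => Subsingleton.elim _ _
  | 1, α, β, h => by
    have h₀ : α 0 = β 0 := star_injective <| by
      rw [← cmvMatrix_apply_zero_zero, h, cmvMatrix_apply_zero_zero]
    ext i
    rwa [Subsingleton.elim i 0]
  | n + 2, α, β, h => by
    rw [cmvMatrix_eq_prepend, cmvMatrix_eq_prepend, prepend_inj] at h
    rw [← Fin.cons_self_tail α, ← Fin.cons_self_tail β, h.1, cmvMatrix_injective h.2]

theorem isVerblunsky_cons_iff {a : ℂ} {α : Fin (n + 1) → ℂ} :
    IsVerblunsky (Fin.cons a α : Fin (n + 2) → ℂ) ↔ ‖a‖ < 1 ∧ IsVerblunsky α := by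
  simp [IsVerblunsky, Fin.forall_fin_succ (n := n + 1), and_assoc]

theorem exists_isVerblunsky_eq_cmvMatrix {U : Matrix (Fin (n + 1)) (Fin (n + 1)) ℂ}
    (hU : U ∈ unitaryGroup (Fin (n + 1)) ℂ) (hshape : HasCMVShape U) :
    ∃ α, IsVerblunsky α ∧ U = cmvMatrix α := by
  induction n with
  | zero =>
    have hnorm : ‖U 0 0‖ = 1 := (pow_eq_one_iff_of_nonneg (norm_nonneg _) two_ne_zero).1
      ((Fin.sum_univ_one _).symm.trans (sum_norm_sq_col_of_mem_unitaryGroup hU 0))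
    refine ⟨fun _ => star (U 0 0), by simp [IsVerblunsky, hnorm], ?_⟩
    ext i j
    rw [Fin.fin_one_eq_zero i, Fin.fin_one_eq_zero j, cmvMatrix_apply_zero_zero, star_star]
  | succ n ih =>
    obtain ⟨a, ha, V, hV, rfl⟩ := exists_eq_prepend hU (hshape.pos_first 1 0 rfl rfl)
      fun i => hshape.zero_left _ _ (by simp only [Fin.val_succ, Fin.val_zero]; omega)
    obtain ⟨α, hα, rfl⟩ := ih hV (hshape.of_prepend ha)
    exact ⟨Fin.cons a α, isVerblunsky_cons_iff.2 ⟨ha, hα⟩, by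
      rw [cmvMatrix_eq_prepend, Fin.cons_zero, Fin.tail_cons]⟩

end CMVMatrix

end CMV

theorem corollaryC (n : ℕ) (hn : 1 ≤ n) (U : Matrix (Fin n) (Fin n) ℂ)
    (hU : U ∈ Matrix.unitaryGroup (Fin n) ℂ) (hshape : CMV.HasCMVShape U) :
    ∃! α : Fin n → ℂ, CMV.IsVerblunsky α ∧ U = CMV.cmvMatrix α := by
  obtain ⟨m, rfl⟩ := Nat.exists_eq_add_of_le' hn
  obtain ⟨α, hα, hUα⟩ := CMV.exists_isVerblunsky_eq_cmvMatrix hU hshape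
  exact ⟨α, ⟨hα, hUα⟩, fun β hβ => CMV.cmvMatrix_injective (hβ.2.symm.trans hUα)⟩
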